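/- Let $\mathcal X$ be a set of datasets with a symmetric neighboring relation $\sim$. For a randomized algorithm $M:\mathcal X\to\mathcal Y$ ($\mathcal Y$ an arbitrary measurable space) and $x\sim x'$ let $P=M(x)$, $Q=M(x')$ denote the output laws. $M$ is $(\varepsilon,\delta)$-DP if $P(S)\le e^{\varepsilon}Q(S)+\delta$ for all $x\sim x'$ and all events $S$, and $\varepsilon$-DP if it is $(\varepsilon,0)$-DP. $M$ is $\alpha$-BR (bounded range) if $P(y_1)/Q(y_1)\le e^{\alpha}P(y_2)/Q(y_2)$ for all $x\sim x'$ and all outcomes $y_1,y_2$; in general: $P(S_1)Q(S_2)\le e^{\alpha}P(S_2)Q(S_1)$ for all events $S_1,S_2$. $M$ is $(\mu,\tau)$-CDP if for all $x\sim x'$ the privacy loss $L=\log\frac{dP}{dQ}(y)$, $y\sim P$, is well defined ($P\ll Q$) and integrable, $\mathbb E[L]\le\mu$, and $\mathbb E[e^{\lambda(L-\mathbb E L)}]\le e^{\lambda^2\tau^2/2}$ for all $\lambda\in\mathbb R$. Let $\mathcal E=(e_i)_{i\in I}$ be a finite preregistered family, where each $e_i$ is a privacy parameter of one of these classes ($\varepsilon$-DP,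 $\alpha$-BR or $(\mu,\tau)$-CDP). In the $\mathcal E$-set-wise adaptive composition experiment $b\in\{0,1\}$ there are $|I|$ rounds. In each round $n$ (with outcomes in a measurable space $\mathcal Y_n$) the analyst chooses, as a deterministic measurable function of the previous outcomes, an index $i\in I$ not used before, a mechanism $M_n$ of the class described by $e_i$, and neighboring datasets $x_n^{(0)}\sim x_n^{(1)}$, and then observes an outcome of $M_n(x_n^{(b)})$. The view $V^{(b)}$ is the resulting sequence of outcomes. $\mathcal E$ is $(\varepsilon_g,\delta)$-differentially private under set-wise adaptive composition if for every analyst, every $b$ and every event $S$, $$\Pr[V^{(b)}\in S]\le e^{\varepsilon_g}\Pr[V^{(1-b)}\in S]+\delta .$$ (In the formulas below, for $\delta>1$ the square root is read as $0$; the claims are then trivial.) 1. Let $\mathcal E=\{(\mu_i,\tau_i): i\in[k]\}$ be CDP parameters. Then for every $\delta>0$, $\mathcal E$ is $(\varepsilon_g,\delta)$-differentially private under set-wise adaptive composition, where $$\varepsilon_g=\sum_{i\in[k]}\mu_i+\sqrt{2\sum_{i\in[k]}\tau_i^2\,\log(1/\delta)} .$$ 2. Let $\varepsilon,\alpha>0$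 and $\mu,\tau\in\mathbb R$, and let $\mathcal E$ consist of $m_{\mathrm{DP}}$ copies of the parameter $\varepsilon$ for $\varepsilon$-DP mechanisms, $m_{\mathrm{BR}}$ copies of the parameter $\alpha$ for $\alpha$-BR mechanisms, and $m_{\mathrm{CDP}}$ copies of the parameter $(\mu,\tau)$ for $(\mu,\tau)$-CDP mechanisms, so that the analyst chooses the class of the mechanism adaptively at each round. Then for every $\delta>0$, $\mathcal E$ is $(\varepsilon_g,\delta)$-differentially private under set-wise adaptive composition, where $$\varepsilon_g=m_{\mathrm{DP}}\,\varepsilon\,\frac{e^{\varepsilon}-1}{e^{\varepsilon}+1}+m_{\mathrm{BR}}\left(\frac{\alpha}{e^{\alpha}-1}-1-\log\frac{\alpha}{e^{\alpha}-1}\right)+m_{\mathrm{CDP}}\,\mu+\sqrt{2\left(m_{\mathrm{DP}}\varepsilon^2+\frac{m_{\mathrm{BR}}}{4}\alpha^2+m_{\mathrm{CDP}}\tau^2\right)\log(1/\delta)} .$$ -/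

import Mathlib

universe u v w

namespace PrivacyComposition

open MeasureTheory ProbabilityTheory

/-- A randomized algorithm with inputs in `X` and outcomes in the measurable space `Y`:
it assigns to every input a probability law on `Y`. -/
abbrev Mechanism (X : Type u) (Y : Type v) [MeasurableSpace Y] : Type (max u v) :=
  X → ProbabilityMeasure Y

section Guarantees

variable {X : Type u} {Y : Type v} [MeasurableSpace Y]

/-- `(ε, δ)`-differential privacy with respect to the neighboring relation `Nbr`. -/
def IsDP (Nbr : X → X → Prop) (M : Mechanism X Y) (ε δ : ℝ) : Prop :=
  ∀ x x' : X, Nbr x x' → ∀ S : Set Y, MeasurableSet S →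
    (M x : Measure Y) S ≤
      ENNReal.ofReal (Real.exp ε) * (M x' : Measure Y) S + ENNReal.ofReal δ

/-- `α`-bounded range: `P(y₁) / Q(y₁) ≤ e^α * (P(y₂) / Q(y₂))` for all outcomes `y₁`, `y₂`, where
`P = M x` and `Q = M x'`. The denominators are cleared and the outcomes are replaced by events, so
that the definition covers continuous outcome spaces; for countable ones it is the inequality above
for the point probabilities. -/
def IsBR (Nbr : X → X → Prop) (M : Mechanism X Y) (α : ℝ) : Prop :=
  ∀ x x' : X, Nbr x x' → ∀ S₁ S₂ : Set Y, MeasurableSet S₁ → MeasurableSet S₂ →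
    (M x : Measure Y) S₁ * (M x' : Measure Y) S₂ ≤
      ENNReal.ofReal (Real.exp α) * ((M x : Measure Y) S₂ * (M x' : Measure Y) S₁)

/-- `(μ, τ)`-concentrated differential privacy. The privacy loss is the log-likelihood ratio
`llr P Q = log (dP/dQ)` of `P = M x` and `Q = M x'`, evaluated at an outcome drawn from `P`; it is
a finite random variable only if `P ≪ Q`. -/
def IsCDP (Nbr : X → X → Prop) (M : Mechanism X Y) (μ τ : ℝ) : Prop :=
  ∀ x x' : X, Nbr x x' →
    let P : Measure Y := M x
    let Q : Measure Y := M x'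
    P ≪ Q ∧ Integrable (llr P Q) P ∧ (∫ y, llr P Q y ∂P) ≤ μ ∧
      ∀ l : ℝ,
        Integrable (fun y => Real.exp (l * (llr P Q y - ∫ z, llr P Q z ∂P))) P ∧
        (∫ y, Real.exp (l * (llr P Q y - ∫ z, llr P Q z ∂P)) ∂P) ≤ Real.exp (l ^ 2 * τ ^ 2 / 2)

end Guarantees

/-- A preregistered privacy parameter, together with the class of mechanisms it belongs to. -/
inductive PrivacyParam : Type
  | pureDP (ε : ℝ)
  | boundedRange (α : ℝ)
  | cdp (μ τ : ℝ)

/-- The mechanism `M` belongs to the class described by the privacy parameter. -/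
def PrivacyParam.Admits {X : Type u} {Y : Type v} [MeasurableSpace Y] (Nbr : X → X → Prop)
    (M : Mechanism X Y) : PrivacyParam → Prop
  | .pureDP ε => IsDP Nbr M ε 0
  | .boundedRange α => IsBR Nbr M α
  | .cdp μ τ => IsCDP Nbr M μ τ

/-- The outcomes of the first `n` rounds, where round `i` has its outcomes in `Y i`. -/
def History (Y : ℕ → Type v) : ℕ → Type v
  | 0 => PUnit
  | n + 1 => History Y n × Y n

/-- The product sigma-algebra on histories. -/
instance History.instMeasurableSpace (Y : ℕ → Type v) [inst : ∀ n, MeasurableSpace (Y n)] :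
    ∀ n, MeasurableSpace (History Y n)
  | 0 => (inferInstance : MeasurableSpace PUnit)
  | n + 1 => @Prod.instMeasurableSpace _ _ (History.instMeasurableSpace Y n) (inst n)

open Classical in
/-- The parameters still available after `n` rounds: all of them at the start, and each round
deletes the parameter that was selected in it. -/
noncomputable def remaining {ι : Type w} [Fintype ι] {Y : ℕ → Type v} {k : ℕ}
    (select : (n : Fin k) → History Y n → ι) : (n : ℕ) → n ≤ k → History Y n → Finset ι
  | 0, _, _ => Finset.univ
  | n + 1, hn, h => (remaining select n (Nat.le_of_succ_le hn) h.1).erase (select ⟨n, hn⟩ h.1)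

/-- An analyst in the set-wise adaptive composition experiment for the family `E` of preregistered
privacy parameters. There is one round for each parameter. In every round the analyst chooses, as a
function of the previous outcomes, one of the remaining parameters, a mechanism of the
corresponding class, and two neighboring datasets. -/
structure Analyst {X : Type u} (Nbr : X → X → Prop) {ι : Type w} [Fintype ι]
    (E : ι → PrivacyParam) (Y : ℕ → Type v) [∀ n, MeasurableSpace (Y n)] where
  select : (n : Fin (Fintype.card ι)) → History Y n → ι
  select_mem : ∀ (n : Fin (Fintype.card ι)) (h : History Y n),
    select n h ∈ remaining select n n.isLt.le h
  mech : (n : Fin (Fintype.card ι)) → History Y n → Mechanism X (Y n)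
  admits : ∀ (n : Fin (Fintype.card ι)) (h : History Y n), (E (select n h)).Admits Nbr (mech n h)
  data : Bool → (n : Fin (Fintype.card ι)) → History Y n → X
  nbr : ∀ (n : Fin (Fintype.card ι)) (h : History Y n), Nbr (data false n h) (data true n h)
  measurableSet_select : ∀ (n : Fin (Fintype.card ι)) (i : ι),
    MeasurableSet {h : History Y n | select n h = i}
  measurable_law : ∀ (b : Bool) (n : Fin (Fintype.card ι)),
    Measurable fun h : History Y n => (mech n h (data b n h) : Measure (Y n))

namespace Analyst

variable {X : Type u} {Nbr : X → X → Prop} {ι : Type w} [Fintype ι] {E : ι → PrivacyParam}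
  {Y : ℕ → Type v} [∀ n, MeasurableSpace (Y n)]

/-- The law of the outcome of round `n` given the previous outcomes, in experiment `b`. -/
noncomputable def outcome (A : Analyst Nbr E Y) (b : Bool) (n : ℕ) (hn : n < Fintype.card ι) :
    Kernel (History Y n) (Y n) where
  toFun h := (A.mech ⟨n, hn⟩ h (A.data b ⟨n, hn⟩ h) : Measure (Y n))
  measurable' := A.measurable_law b ⟨n, hn⟩

instance (A : Analyst Nbr E Y) (b : Bool) (n : ℕ) (hn : n < Fintype.card ι) :
    IsMarkovKernel (A.outcome b n hn) :=
  ⟨fun h => (A.mech ⟨n, hn⟩ h (A.data b ⟨n, hn⟩ h)).2⟩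

/-- The law of the outcomes of the first `n` rounds in experiment `b`. -/
noncomputable def historyLaw (A : Analyst Nbr E Y) (b : Bool) :
    (n : ℕ) → n ≤ Fintype.card ι → Measure (History Y n)
  | 0, _ => Measure.dirac PUnit.unit
  | n + 1, hn =>
    Measure.compProd (historyLaw A b n (Nat.le_of_succ_le hn)) (A.outcome b n hn)

theorem isProbabilityMeasure_historyLaw (A : Analyst Nbr E Y) (b : Bool) :
    ∀ (n : ℕ) (hn : n ≤ Fintype.card ι), IsProbabilityMeasure (A.historyLaw b n hn)
  | 0, _ => by
    unfold historyLaw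
    exact Measure.dirac.isProbabilityMeasure
  | n + 1, hn => by
    have := isProbabilityMeasure_historyLaw A b n (Nat.le_of_succ_le hn)
    exact inferInstanceAs (IsProbabilityMeasure
      (Measure.compProd (A.historyLaw b n (Nat.le_of_succ_le hn)) (A.outcome b n hn)))

/-- The law of the view of the analyst in experiment `b`: all outcomes of the interaction, which
runs until no parameter remains. (The choices of the analyst are functions of the outcomes.) -/
noncomputable def view (A : Analyst Nbr E Y) (b : Bool) : Measure (History Y (Fintype.card ι)) :=
  A.historyLaw b (Fintype.card ι) le_rfl

end Analyst

/-- The family `E` of privacy parameters is `(ε, δ)`-differentially private under set-wise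
adaptive composition. -/
def SetwiseDP {X : Type u} (Nbr : X → X → Prop) {ι : Type w} [Fintype ι]
    (E : ι → PrivacyParam) (ε δ : ℝ) : Prop :=
  ∀ (Y : ℕ → Type v) [∀ n, MeasurableSpace (Y n)] (A : Analyst Nbr E Y) (b : Bool)
    (S : Set (History Y (Fintype.card ι))), MeasurableSet S →
    A.view b S ≤ ENNReal.ofReal (Real.exp ε) * A.view (!b) S + ENNReal.ofReal δ

end PrivacyComposition

/-! Pure DP and bounded range both imply CDP with explicit constants, so it suffices to compose CDP
mechanisms. For output laws `P`, `Q` with constants `μ`, `τ` and any `l > 0`, the CDP moment bound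
gives `∫ (dP/dQ)^(1+l) dQ ≤ exp (l μ + l² τ² / 2)`. By Hölder, with `q = (1+l)/l`, the `P`-integral
of any `f ≥ 0` is then at most a constant times the `L^q(Q)` norm of `f`
(`ConcentratedLoss.lintegral_le_rpow`).

This form composes well: it is applied separately at each history, so no density jointly measurable
in history and outcome is needed. Carrying the product of the constants of the unused parameters as
a weight makes the induction insensitive to the adaptive order (`Analyst.lintegral_historyLaw_le`).
All parameters are used in the end, so the total constant is the full product.

For the indicator of an event this compares its two probabilities. Splitting on whether their ratio
exceeds `e^t` yields an additive error `exp (l ∑ μ + l² ∑ τ² / 2 - l t)`, and optimizing `l` gives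
the stated formula. -/

namespace PrivacyComposition

open MeasureTheory ProbabilityTheory

/-! ### Privacy loss for a single pair of output laws -/

section Pairs

variable {Y : Type v} [MeasurableSpace Y]

/-- The guarantee of `IsCDP` for a single pair of output laws. -/
def ConcentratedLoss (P Q : Measure Y) (μ τ : ℝ) : Prop :=
  P ≪ Q ∧ Integrable (llr P Q) P ∧ (∫ y, llr P Q y ∂P) ≤ μ ∧
    ∀ l : ℝ,
      Integrable (fun y => Real.exp (l * (llr P Q y - ∫ z, llr P Q z ∂P))) P ∧
      (∫ y, Real.exp (l * (llr P Q y - ∫ z, llr P Q z ∂P)) ∂P) ≤ Real.exp (l ^ 2 * τ ^ 2 / 2)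

/-- The mean of the loss is bounded only from above, hence the restriction to `0 ≤ l`. -/
theorem ConcentratedLoss.lintegral_exp_mul_llr_le {P Q : Measure Y} {μ τ : ℝ}
    (h : ConcentratedLoss P Q μ τ) {l : ℝ} (hl : 0 ≤ l) :
    ∫⁻ y, ENNReal.ofReal (Real.exp (l * llr P Q y)) ∂P ≤
      ENNReal.ofReal (Real.exp (l * μ + l ^ 2 * τ ^ 2 / 2)) := by
  obtain ⟨-, -, hμ, hm⟩ := h
  obtain ⟨hi, hle⟩ := hm l
  set m := ∫ z, llr P Q z ∂P
  have key : ∀ y, Real.exp (l * llr P Q y) =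
      Real.exp (l * m) * Real.exp (l * (llr P Q y - m)) := fun y => by
    rw [← Real.exp_add]; ring_nf
  simp_rw [key]
  rw [← ofReal_integral_eq_lintegral_ofReal (hi.const_mul _)
    (Filter.Eventually.of_forall fun y => by positivity), integral_const_mul]
  apply ENNReal.ofReal_le_ofReal
  rw [Real.exp_add]
  gcongr

/-- The Hölder form of a bound on the Rényi divergence of order `1 + l`. -/
theorem ConcentratedLoss.lintegral_le_rpow {P Q : Measure Y} [IsProbabilityMeasure P]
    [IsProbabilityMeasure Q] {μ τ : ℝ} (h : ConcentratedLoss P Q μ τ) {l : ℝ} (hl : 0 < l)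
    {f : Y → ENNReal} (hf : Measurable f) :
    ∫⁻ y, f y ∂P ≤ ENNReal.ofReal (Real.exp ((l * μ + l ^ 2 * τ ^ 2 / 2) / (1 + l))) *
      (∫⁻ y, f y ^ ((1 + l) / l) ∂Q) ^ (l / (1 + l)) := by
  have hac := h.1
  have hg : Measurable (P.rnDeriv Q) := Measure.measurable_rnDeriv P Q
  have hpq : (1 + l).HolderConjugate ((1 + l) / l) := by
    rw [Real.holderConjugate_iff]
    refine ⟨by linarith, ?_⟩
    field_simp
  have hpow : ∫⁻ y, P.rnDeriv Q y ^ (1 + l) ∂Q ≤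
      ENNReal.ofReal (Real.exp (l * μ + l ^ 2 * τ ^ 2 / 2)) := by
    refine le_trans (le_of_eq ?_) (h.lintegral_exp_mul_llr_le hl.le)
    have hmeas : Measurable fun y => P.rnDeriv Q y ^ l := hg.pow_const l
    calc ∫⁻ y, P.rnDeriv Q y ^ (1 + l) ∂Q
        = ∫⁻ y, P.rnDeriv Q y * P.rnDeriv Q y ^ l ∂Q := by
          refine lintegral_congr fun y => ?_
          rw [ENNReal.rpow_add_of_nonneg _ _ zero_le_one hl.le, ENNReal.rpow_one]
      _ = ∫⁻ y, P.rnDeriv Q y ^ l ∂P := lintegral_rnDeriv_mul hac hmeas.aemeasurable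
      _ = ∫⁻ y, ENNReal.ofReal (Real.exp (l * llr P Q y)) ∂P := by
          refine lintegral_congr_ae ?_
          filter_upwards [exp_llr_of_ac P Q hac, hac.ae_le (Measure.rnDeriv_lt_top P Q)]
            with y hy hlt
          rw [mul_comm, Real.exp_mul, ← ENNReal.ofReal_rpow_of_pos (Real.exp_pos _), hy,
            ENNReal.ofReal_toReal hlt.ne]
  calc ∫⁻ y, f y ∂P = ∫⁻ y, (P.rnDeriv Q * f) y ∂Q :=
        (lintegral_rnDeriv_mul hac hf.aemeasurable).symm
    _ ≤ (∫⁻ y, P.rnDeriv Q y ^ (1 + l) ∂Q) ^ (1 / (1 + l)) *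
        (∫⁻ y, f y ^ ((1 + l) / l) ∂Q) ^ (1 / ((1 + l) / l)) :=
        ENNReal.lintegral_mul_le_Lp_mul_Lq Q hpq hg.aemeasurable hf.aemeasurable
    _ ≤ _ := by
        rw [one_div_div]
        gcongr
        refine (ENNReal.rpow_le_rpow hpow (by positivity)).trans_eq ?_
        rw [ENNReal.ofReal_rpow_of_pos (Real.exp_pos _), ← Real.exp_mul, mul_one_div]

/-- A convexity bound: on `[0, a]` the identity lies below a multiple of `1 - exp (-x)`. -/
theorem le_one_sub_exp_neg_mul {a x : ℝ} (ha : 0 < a) (h0 : 0 ≤ x) (hx : x ≤ a) :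
    x ≤ (1 - Real.exp (-x)) * (a * Real.exp a / (Real.exp a - 1)) := by
  have h1 : 1 < Real.exp a := Real.one_lt_exp_iff.2 ha
  -- The chord of `exp` over `[-a, 0]`, evaluated at `-x` with weight `x / a` on `-a`.
  have hc := convexOn_exp.2 (Set.mem_univ 0) (Set.mem_univ (-a))
    (sub_nonneg.2 ((div_le_one ha).2 hx)) (div_nonneg h0 ha.le) (by ring)
  simp only [smul_eq_mul, mul_zero, zero_add, Real.exp_zero, mul_one] at hc
  rw [show x / a * -a = -x by field_simp, Real.exp_neg a] at hc
  have hc' : x / a * (1 - (Real.exp a)⁻¹) ≤ 1 - Real.exp (-x) := by linarith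
  have hpos : 0 < a * Real.exp a / (Real.exp a - 1) :=
    div_pos (by positivity) (by linarith)
  have := mul_le_mul_of_nonneg_right hc' hpos.le
  refine le_trans (le_of_eq ?_) this
  have : Real.exp a - 1 ≠ 0 := by linarith
  field_simp

/-- If the log-likelihood ratio has range in an interval of length `a`, then Hoeffding's lemma and
convexity control the privacy loss. -/
theorem concentratedLoss_of_llr_mem_Icc {P Q : Measure Y} [IsProbabilityMeasure P]
    [IsProbabilityMeasure Q] (hPQ : P ≪ Q) (hQP : Q ≪ P) {s a : ℝ} (ha : 0 < a)
    (h : ∀ᵐ y ∂P, llr P Q y ∈ Set.Icc s (s + a)) :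
    ConcentratedLoss P Q (s + (1 - Real.exp s) * (a * Real.exp a / (Real.exp a - 1))) (a / 2) := by
  have hm : AEMeasurable (llr P Q) P := (measurable_llr P Q).aemeasurable
  have hi : Integrable (llr P Q) P := Integrable.of_mem_Icc _ _ hm h
  have hsub := hasSubgaussianMGF_of_mem_Icc hm h
  refine ⟨hPQ, hi, ?_, fun l => ⟨hsub.integrable_exp_mul l, (hsub.mgf_le l).trans_eq ?_⟩⟩
  · set B := a * Real.exp a / (Real.exp a - 1)
    have he := exp_neg_llr hPQ
    have hei : Integrable (fun y => Real.exp (-llr P Q y)) P :=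
      (integrable_congr he).2 Measure.integrable_toReal_rnDeriv
    -- The `P`-mean of `exp (-L)` is the full mass of `Q`, because `Q ≪ P`.
    have he1 : ∫ y, Real.exp (-llr P Q y) ∂P = 1 := by
      rw [integral_congr_ae he, Measure.integral_toReal_rnDeriv hQP]
      simp
    -- The chord bound at `L - s` dominates `L` by an affine function of `exp (-L)`, whose mean is
    -- known exactly.
    have hbound : ∀ᵐ y ∂P, llr P Q y ≤ s + B - Real.exp s * B * Real.exp (-llr P Q y) := by
      filter_upwards [h] with y hy
      have := le_one_sub_exp_neg_mul ha (sub_nonneg.2 hy.1) (by linarith [hy.2] : _ ≤ a)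
      rw [show -(llr P Q y - s) = s + -llr P Q y by ring, Real.exp_add] at this
      simp only [B]
      linarith
    have hint : Integrable (fun y => s + B - Real.exp s * B * Real.exp (-llr P Q y)) P :=
      (integrable_const _).sub (hei.const_mul _)
    refine (integral_mono_ae hi hint hbound).trans_eq ?_
    rw [integral_sub (integrable_const _) (hei.const_mul _), integral_const_mul, he1]
    simp
    ring
  · congr 1
    simp [abs_of_pos ha]
    ring

theorem ConcentratedLoss.mono {P Q : Measure Y} {μ μ' τ : ℝ} (h : ConcentratedLoss P Q μ τ)
    (hμ : μ ≤ μ') : ConcentratedLoss P Q μ' τ :=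
  ⟨h.1, h.2.1, h.2.2.1.trans hμ, h.2.2.2⟩

theorem absolutelyContinuous_of_le_mul {P Q : Measure Y} {c : ENNReal}
    (h : ∀ S, MeasurableSet S → P S ≤ c * Q S) : P ≪ Q :=
  Measure.AbsolutelyContinuous.mk fun S hS h0 => by
    have := h S hS
    rwa [h0, mul_zero, nonpos_iff_eq_zero] at this

theorem rnDeriv_le_of_le_mul {P Q : Measure Y} [IsFiniteMeasure P] [IsFiniteMeasure Q]
    {c : ENNReal} (h : ∀ S, MeasurableSet S → P S ≤ c * Q S) :
    ∀ᵐ y ∂Q, P.rnDeriv Q y ≤ c :=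
  ae_le_of_forall_setLIntegral_le_of_sigmaFinite (Measure.measurable_rnDeriv P Q)
    fun S hS _ => by
      rw [lintegral_const, Measure.restrict_apply_univ]
      exact (Measure.setLIntegral_rnDeriv_le S).trans (h S hS)

theorem llr_mem_Icc_of_le_mul {P Q : Measure Y} [IsFiniteMeasure P] [IsFiniteMeasure Q] {a : ℝ}
    (hP : ∀ S, MeasurableSet S → P S ≤ ENNReal.ofReal (Real.exp a) * Q S)
    (hQ : ∀ S, MeasurableSet S → Q S ≤ ENNReal.ofReal (Real.exp a) * P S) :
    ∀ᵐ y ∂P, llr P Q y ∈ Set.Icc (-a) a := by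
  have hPQ := absolutelyContinuous_of_le_mul hP
  filter_upwards [exp_llr_of_ac P Q hPQ, exp_neg_llr hPQ, hPQ.ae_le (rnDeriv_le_of_le_mul hP),
    rnDeriv_le_of_le_mul hQ] with y h1 h2 h3 h4
  have h5 := ENNReal.toReal_le_of_le_ofReal (Real.exp_pos a).le h3
  have h6 := ENNReal.toReal_le_of_le_ofReal (Real.exp_pos a).le h4
  rw [← h1, Real.exp_le_exp] at h5
  rw [← h2, Real.exp_le_exp] at h6
  exact ⟨by linarith, h5⟩

/-- The loss lies in `[-a, a]`, of length `2 * a`; the interval bound with `s = -a` simplifies to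
this mean. -/
theorem concentratedLoss_of_le_mul {P Q : Measure Y} [IsProbabilityMeasure P]
    [IsProbabilityMeasure Q] {a : ℝ} (ha : 0 < a)
    (hP : ∀ S, MeasurableSet S → P S ≤ ENNReal.ofReal (Real.exp a) * Q S)
    (hQ : ∀ S, MeasurableSet S → Q S ≤ ENNReal.ofReal (Real.exp a) * P S) :
    ConcentratedLoss P Q (a * ((Real.exp a - 1) / (Real.exp a + 1))) a := by
  have hL : ∀ᵐ y ∂P, llr P Q y ∈ Set.Icc (-a) (-a + 2 * a) := by
    simpa only [show -a + 2 * a = a by ring] using llr_mem_Icc_of_le_mul hP hQ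
  have h := concentratedLoss_of_llr_mem_Icc (absolutelyContinuous_of_le_mul hP)
    (absolutelyContinuous_of_le_mul hQ) (by linarith : 0 < 2 * a) hL
  rw [show 2 * a / 2 = a by ring] at h
  refine h.mono (le_of_eq ?_)
  have h1 : 1 < Real.exp a := Real.one_lt_exp_iff.2 ha
  have h2 : Real.exp a - 1 ≠ 0 := by linarith
  have h3 : Real.exp a + 1 ≠ 0 := by linarith
  rw [two_mul a, Real.exp_add, Real.exp_neg,
    show Real.exp a * Real.exp a - 1 = (Real.exp a - 1) * (Real.exp a + 1) by ring]
  field_simp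
  ring

theorem measure_le_of_llr_le {P Q : Measure Y} [IsFiniteMeasure P] [IsFiniteMeasure Q]
    (hPQ : P ≪ Q) (hQP : Q ≪ P) {c : ℝ} {S : Set Y}
    (h : ∀ y ∈ S, llr P Q y ≤ c) : P S ≤ ENNReal.ofReal (Real.exp c) * Q S := by
  rw [← Measure.setLIntegral_rnDeriv hPQ S, ← setLIntegral_const]
  refine setLIntegral_mono_ae measurable_const.aemeasurable ?_
  filter_upwards [exp_llr_of_ac' P Q hQP, Measure.rnDeriv_ne_top P Q] with y h1 h2 hy
  rw [← ENNReal.ofReal_toReal h2, ← h1]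
  exact ENNReal.ofReal_le_ofReal (Real.exp_le_exp.2 (h y hy))

theorem le_measure_of_le_llr {P Q : Measure Y} [IsFiniteMeasure P] [IsFiniteMeasure Q]
    (hPQ : P ≪ Q) (hQP : Q ≪ P) {c : ℝ} {S : Set Y}
    (h : ∀ y ∈ S, c ≤ llr P Q y) : ENNReal.ofReal (Real.exp c) * Q S ≤ P S := by
  rw [← Measure.setLIntegral_rnDeriv hPQ S, ← setLIntegral_const]
  refine setLIntegral_mono_ae (Measure.measurable_rnDeriv P Q).aemeasurable ?_
  filter_upwards [exp_llr_of_ac' P Q hQP, Measure.rnDeriv_ne_top P Q] with y h1 h2 hy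
  rw [← ENNReal.ofReal_toReal h2, ← h1]
  exact ENNReal.ofReal_le_ofReal (Real.exp_le_exp.2 (h y hy))

/-- Bounded range confines the log-likelihood ratio to an interval of length `a`. -/
theorem exists_llr_mem_Icc_of_mul_le_mul {P Q : Measure Y} [IsProbabilityMeasure P]
    [IsProbabilityMeasure Q] {a : ℝ} (hPQ : P ≪ Q) (hQP : Q ≪ P)
    (hb : ∀ᵐ y ∂P, llr P Q y ∈ Set.Icc (-a) a)
    (h : ∀ S₁ S₂, MeasurableSet S₁ → MeasurableSet S₂ →
      P S₁ * Q S₂ ≤ ENNReal.ofReal (Real.exp a) * (P S₂ * Q S₁)) :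
    ∃ s, ∀ᵐ y ∂P, llr P Q y ∈ Set.Icc s (s + a) := by
  have hL := measurable_llr P Q
  -- If the loss were at least `c' + a` on one event and at most `c` on another, both of positive
  -- measure, their likelihood ratios would differ by a factor above `e^a`. The gap `c < c'`
  -- supplies the strictness.
  have hdich : ∀ c c' : ℝ, c < c' →
      (∀ᵐ y ∂P, llr P Q y < c' + a) ∨ ∀ᵐ y ∂P, c < llr P Q y := by
    intro c c' hc
    set S₁ := {y | c' + a ≤ llr P Q y}
    set S₂ := {y | llr P Q y ≤ c}
    have hS₁ : MeasurableSet S₁ := measurableSet_le measurable_const hL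
    have hS₂ : MeasurableSet S₂ := measurableSet_le hL measurable_const
    have h1 := le_measure_of_le_llr hPQ hQP (S := S₁) (c := c' + a) fun y hy => hy
    have h2 := measure_le_of_llr_le hPQ hQP (S := S₂) (c := c) fun y hy => hy
    have h3 : ENNReal.ofReal (Real.exp (c' + a)) * (Q S₁ * Q S₂) ≤
        ENNReal.ofReal (Real.exp (c + a)) * (Q S₁ * Q S₂) := calc
      _ = ENNReal.ofReal (Real.exp (c' + a)) * Q S₁ * Q S₂ := (mul_assoc _ _ _).symm
      _ ≤ P S₁ * Q S₂ := by gcongr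
      _ ≤ ENNReal.ofReal (Real.exp a) * (P S₂ * Q S₁) := h S₁ S₂ hS₁ hS₂
      _ ≤ ENNReal.ofReal (Real.exp a) * (ENNReal.ofReal (Real.exp c) * Q S₂ * Q S₁) := by gcongr
      _ = _ := by
        rw [add_comm c a, Real.exp_add, ENNReal.ofReal_mul (Real.exp_pos _).le]; ring
    have h4 : Q S₁ * Q S₂ = 0 := by
      by_contra hne
      have hfin : Q S₁ * Q S₂ ≠ ⊤ := ENNReal.mul_ne_top (measure_ne_top _ _) (measure_ne_top _ _)
      have h5 := (ENNReal.mul_le_mul_iff_left hne hfin).1 h3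
      rw [ENNReal.ofReal_le_ofReal_iff (Real.exp_pos _).le, Real.exp_le_exp] at h5
      linarith
    rcases mul_eq_zero.1 h4 with h0 | h0
    · exact Or.inl (by simpa [ae_iff, S₁] using hPQ h0)
    · exact Or.inr (by simpa [ae_iff, S₂] using hPQ h0)
  have hne : (ae P).NeBot := inferInstance
  have hbdd : Filter.IsBoundedUnder (· ≥ ·) (ae P) (llr P Q) :=
    ⟨-a, Filter.eventually_map.2 (hb.mono fun y hy => hy.1)⟩
  have hbdd' : Filter.IsBoundedUnder (· ≤ ·) (ae P) (llr P Q) :=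
    ⟨a, Filter.eventually_map.2 (hb.mono fun y hy => hy.2)⟩
  refine ⟨essInf (llr P Q) P, ?_⟩
  -- Take `c` and `c'` to exceed the essential infimum by `1/(n+1)` and `2/(n+1)`. The second
  -- alternative would make `c` an essential lower bound above the infimum.
  have hub : ∀ n : ℕ, ∀ᵐ y ∂P, llr P Q y < essInf (llr P Q) P + 2 * (1 / ((n : ℝ) + 1)) + a := by
    intro n
    have hn : 0 < 1 / ((n : ℝ) + 1) := by positivity
    refine (hdich (essInf (llr P Q) P + 1 / ((n : ℝ) + 1)) _ (by linarith)).resolve_right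
      fun hlt => ?_
    have := le_essInf_of_ae_le (μ := P) (f := llr P Q) _ (hlt.mono fun y hy => hy.le)
      hbdd'.isCoboundedUnder_ge
    linarith
  filter_upwards [ae_essInf_le hbdd, ae_all_iff.2 hub] with y h1 h2
  refine ⟨h1, ?_⟩
  have hlim := ((tendsto_one_div_add_atTop_nhds_zero_nat (𝕜 := ℝ)).const_mul 2).const_add
    (essInf (llr P Q) P) |>.add_const a
  rw [mul_zero, add_zero] at hlim
  exact ge_of_tendsto' hlim fun n => (h2 n).le

/-- The position `s` of the interval is unknown, so the mean bound is maximized over `s`. -/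
theorem concentratedLoss_of_mul_le_mul {P Q : Measure Y} [IsProbabilityMeasure P]
    [IsProbabilityMeasure Q] {a : ℝ} (ha : 0 < a)
    (h : ∀ S₁ S₂, MeasurableSet S₁ → MeasurableSet S₂ →
      P S₁ * Q S₂ ≤ ENNReal.ofReal (Real.exp a) * (P S₂ * Q S₁)) :
    ConcentratedLoss P Q
      (a / (Real.exp a - 1) - 1 - Real.log (a / (Real.exp a - 1))) (a / 2) := by
  have hP : ∀ S, MeasurableSet S → P S ≤ ENNReal.ofReal (Real.exp a) * Q S := fun S hS => by
    simpa using h S Set.univ hS .univ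
  have hQ : ∀ S, MeasurableSet S → Q S ≤ ENNReal.ofReal (Real.exp a) * P S := fun S hS => by
    simpa using h Set.univ S .univ hS
  have hPQ := absolutelyContinuous_of_le_mul hP
  have hQP := absolutelyContinuous_of_le_mul hQ
  obtain ⟨s, hs⟩ := exists_llr_mem_Icc_of_mul_le_mul hPQ hQP (llr_mem_Icc_of_le_mul hP hQ) h
  refine (concentratedLoss_of_llr_mem_Icc hPQ hQP ha hs).mono ?_
  have h1 : 0 < Real.exp a - 1 := sub_pos.2 (Real.one_lt_exp_iff.2 ha)
  have hA : 0 < a / (Real.exp a - 1) := div_pos ha h1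
  have hB : a * Real.exp a / (Real.exp a - 1) = a / (Real.exp a - 1) + a := by
    field_simp; ring
  have hB' : a * Real.exp a / (Real.exp a - 1) = Real.exp a * (a / (Real.exp a - 1)) := by ring
  -- The maximization over `s` is `log x ≤ x - 1` at `x = e^(s+a) * a / (e^a - 1)`, with equality at
  -- the worst `s`.
  have hlog := Real.log_le_sub_one_of_pos
    (mul_pos (Real.exp_pos s) (mul_pos (Real.exp_pos a) hA))
  rw [Real.log_mul (Real.exp_ne_zero _) (mul_pos (Real.exp_pos a) hA).ne',
    Real.log_mul (Real.exp_ne_zero _) hA.ne', Real.log_exp, Real.log_exp, ← hB'] at hlog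
  rw [sub_mul, one_mul]
  linarith

end Pairs

/-! ### Pure DP and bounded range as instances of CDP -/

section Mechanisms

variable {X : Type u} {Y : Type v} [MeasurableSpace Y] {Nbr : X → X → Prop} {M : Mechanism X Y}

theorem IsDP.isCDP (hNbr : ∀ x x', Nbr x x' → Nbr x' x) {ε : ℝ} (hε : 0 < ε)
    (h : IsDP Nbr M ε 0) :
    IsCDP Nbr M (ε * ((Real.exp ε - 1) / (Real.exp ε + 1))) ε := fun x x' hx =>
  concentratedLoss_of_le_mul hε (fun S hS => by simpa using h x x' hx S hS)
    (fun S hS => by simpa using h x' x (hNbr x x' hx) S hS)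

theorem IsBR.isCDP {α : ℝ} (hα : 0 < α) (h : IsBR Nbr M α) :
    IsCDP Nbr M (α / (Real.exp α - 1) - 1 - Real.log (α / (Real.exp α - 1))) (α / 2) :=
  fun x x' hx => concentratedLoss_of_mul_le_mul hα (h x x' hx)

end Mechanisms

/-! ### Hölder inequalities along the adaptive interaction -/

namespace Analyst

variable {X : Type u} {Nbr : X → X → Prop} {ι : Type w} [Fintype ι] {E : ι → PrivacyParam}
  {Y : ℕ → Type v} [∀ n, MeasurableSpace (Y n)]

theorem data_nbr (A : Analyst Nbr E Y) (hNbr : ∀ x x', Nbr x x' → Nbr x' x) (b : Bool)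
    (n : Fin (Fintype.card ι)) (h : History Y n) : Nbr (A.data b n h) (A.data (!b) n h) := by
  cases b
  · exact A.nbr n h
  · exact hNbr _ _ (A.nbr n h)

/-- Guarantees that no parameter is left after the last round, so that the weight in the induction
becomes an empty product. -/
theorem card_remaining (A : Analyst Nbr E Y) : ∀ (n : ℕ) (hn : n ≤ Fintype.card ι)
    (h : History Y n), (remaining A.select n hn h).card = Fintype.card ι - n
  | 0, _, _ => by simp [remaining, Finset.card_univ]
  | n + 1, hn, h => by
    classical
    rw [remaining, Finset.card_erase_of_mem (A.select_mem ⟨n, hn⟩ h.1),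
      card_remaining A n _ h.1, Nat.sub_sub]

theorem measurableSet_mem_remaining (A : Analyst Nbr E Y) (i : ι) :
    ∀ (n : ℕ) (hn : n ≤ Fintype.card ι),
      MeasurableSet {h : History Y n | i ∈ remaining A.select n hn h}
  | 0, _ => by simp [remaining]
  | n + 1, hn => by
    have h1 := (A.measurableSet_select ⟨n, hn⟩ i).compl.inter
      (measurableSet_mem_remaining A i n (Nat.le_of_succ_le hn))
    have h2 : {h : History Y (n + 1) | i ∈ remaining A.select (n + 1) hn h} =
        Prod.fst ⁻¹' ({h | A.select ⟨n, hn⟩ h = i}ᶜ ∩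
          {h | i ∈ remaining A.select n (Nat.le_of_succ_le hn) h}) := by
      ext h
      classical
      rw [Set.mem_ofPred_eq, remaining, Finset.mem_erase, ne_comm]
      rfl
    rw [h2]
    exact (measurable_fst (α := History Y n) (β := Y n)) h1

theorem measurable_prod_remaining (A : Analyst Nbr E Y) (c : ι → ENNReal) (n : ℕ)
    (hn : n ≤ Fintype.card ι) :
    Measurable fun h : History Y n => ∏ i ∈ remaining A.select n hn h, c i := by
  classical
  have key : (fun h : History Y n => ∏ i ∈ remaining A.select n hn h, c i) =
      fun h => ∏ i, if i ∈ remaining A.select n hn h then c i else 1 := by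
    ext h
    rw [Finset.prod_ite_mem, Finset.univ_inter]
  rw [key]
  exact Finset.measurable_prod _ fun i _ =>
    Measurable.ite (A.measurableSet_mem_remaining i n hn) measurable_const measurable_const

/-- Hölder inequalities for the single rounds compose to one for the history. Every round pays the
factor of the parameter selected in it, whichever that is. -/
theorem lintegral_historyLaw_le (A : Analyst Nbr E Y) (b : Bool) (c : ι → ENNReal) {q : ℝ}
    (hq : 0 < q)
    (hc : ∀ (n : ℕ) (hn : n < Fintype.card ι) (h : History Y n) (f : Y n → ENNReal),
      Measurable f → ∫⁻ y, f y ∂(A.outcome b n hn h) ≤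
        c (A.select ⟨n, hn⟩ h) * (∫⁻ y, f y ^ q ∂(A.outcome (!b) n hn h)) ^ q⁻¹) :
    ∀ (n : ℕ) (hn : n ≤ Fintype.card ι) (f : History Y n → ENNReal), Measurable f →
      ∫⁻ h, f h * ∏ i ∈ remaining A.select n hn h, c i ∂(A.historyLaw b n hn) ≤
        (∏ i, c i) * (∫⁻ h, f h ^ q ∂(A.historyLaw (!b) n hn)) ^ q⁻¹
  | 0, hn, f, hf => by
    have hg := hf.mul (A.measurable_prod_remaining c 0 hn)
    refine le_of_eq ?_
    simp only [historyLaw]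
    refine (lintegral_dirac' (PUnit.unit : History Y 0) hg).trans ?_
    refine Eq.trans ?_ (congrArg (fun z => (∏ i, c i) * z ^ q⁻¹)
      (lintegral_dirac' (PUnit.unit : History Y 0) (hf.pow_const q))).symm
    rw [ENNReal.rpow_rpow_inv hq.ne', mul_comm]
    rfl
  | n + 1, hn, f, hf => by
    have hn' := Nat.le_of_succ_le hn
    have hp := A.isProbabilityMeasure_historyLaw b n hn'
    have hp' := A.isProbabilityMeasure_historyLaw (!b) n hn'
    let W : History Y n → ENNReal := fun h => ∏ i ∈ remaining A.select n hn' h, c i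
    let F : History Y n → ENNReal := fun h =>
      (∫⁻ y, f (h, y) ^ q ∂(A.outcome (!b) n hn h)) ^ q⁻¹
    have hfq : Measurable fun z : History Y n × Y n => f z ^ q := hf.pow_const q
    have hF : Measurable F := (hfq.lintegral_kernel_prod_right').pow_const _
    calc ∫⁻ h, f h * ∏ i ∈ remaining A.select (n + 1) hn h, c i ∂(A.historyLaw b (n + 1) hn)
        = ∫⁻ h, ∫⁻ y, f (h, y) * ∏ i ∈ remaining A.select (n + 1) hn (h, y), c i
            ∂(A.outcome b n hn h) ∂(A.historyLaw b n hn') :=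
          Measure.lintegral_compProd (hf.mul (A.measurable_prod_remaining c (n + 1) hn))
      _ ≤ ∫⁻ h, F h * W h ∂(A.historyLaw b n hn') := by
          refine lintegral_mono fun h => ?_
          have hfh : Measurable fun y => f (h, y) :=
            hf.comp (measurable_prodMk_left (α := History Y n) (β := Y n))
          simp only [remaining]
          rw [lintegral_mul_const _ hfh]
          refine (mul_le_mul_left (hc n hn h _ hfh) _).trans_eq ?_
          classical
          simp only [W, F]
          -- The Hölder constant of this round is exactly the factor erased from the weight.
          rw [← Finset.mul_prod_erase _ c (A.select_mem ⟨n, hn⟩ h), mul_comm (c _), mul_assoc]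
      _ ≤ (∏ i, c i) * (∫⁻ h, F h ^ q ∂(A.historyLaw (!b) n hn')) ^ q⁻¹ :=
          lintegral_historyLaw_le A b c hq hc n hn' F hF
      _ = (∏ i, c i) * (∫⁻ h, f h ^ q ∂(A.historyLaw (!b) (n + 1) hn)) ^ q⁻¹ := by
          simp only [F, ENNReal.rpow_inv_rpow hq.ne']
          congr 2
          exact (Measure.lintegral_compProd hfq).symm

theorem view_le_rpow (A : Analyst Nbr E Y) (b : Bool) (c : ι → ENNReal) {q : ℝ}
    (hq : 0 < q)
    (hc : ∀ (n : ℕ) (hn : n < Fintype.card ι) (h : History Y n) (f : Y n → ENNReal),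
      Measurable f → ∫⁻ y, f y ∂(A.outcome b n hn h) ≤
        c (A.select ⟨n, hn⟩ h) * (∫⁻ y, f y ^ q ∂(A.outcome (!b) n hn h)) ^ q⁻¹)
    {S : Set (History Y (Fintype.card ι))} (hS : MeasurableSet S) :
    A.view b S ≤ (∏ i, c i) * A.view (!b) S ^ q⁻¹ := by
  have h := A.lintegral_historyLaw_le b c hq hc _ le_rfl (S.indicator 1)
    (measurable_one.indicator hS)
  have hr : ∀ h : History Y (Fintype.card ι), remaining A.select _ le_rfl h = ∅ := fun h => by
    rw [← Finset.card_eq_zero, A.card_remaining, Nat.sub_self]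
  have hi : ∀ h, (S.indicator 1 h : ENNReal) ^ q = S.indicator 1 h := fun h => by
    by_cases hh : h ∈ S <;> simp [hh, hq]
  simpa only [hr, hi, Finset.prod_empty, mul_one, lintegral_indicator_one hS, view] using h

end Analyst

/-! ### From Hölder inequalities to approximate differential privacy -/

/-- A Hölder inequality between the probabilities of an event bounds one by a multiple of the
other, up to a small additive error. -/
theorem le_exp_mul_add_of_le_rpow {a a' : ENNReal} {l c t : ℝ} (hl : 0 < l) (ha : a ≠ ⊤)
    (h : a ≤ ENNReal.ofReal (Real.exp (c / (1 + l))) * a' ^ ((1 + l) / l)⁻¹) :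
    a ≤ ENNReal.ofReal (Real.exp t) * a' + ENNReal.ofReal (Real.exp (c - l * t)) := by
  -- Either the multiplicative term alone suffices, or `a' ≤ e^(-t) a`; inserting the latter into
  -- `a^(1+l) ≤ e^c a'^l` leaves `a ≤ e^(c - l t)`.
  rcases le_total a (ENNReal.ofReal (Real.exp t) * a') with h1 | h1
  · exact h1.trans le_self_add
  refine le_trans ?_ le_add_self
  have ha' : a' ≠ ⊤ := by
    rintro rfl
    rw [ENNReal.mul_top (by simp [Real.exp_pos])] at h1
    exact ha (top_le_iff.1 h1)
  lift a to NNReal using ha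
  lift a' to NNReal using ha'
  have hl1 : 0 < 1 + l := by linarith
  rw [ENNReal.ofReal, ← ENNReal.coe_mul, ENNReal.coe_le_coe, ← NNReal.coe_le_coe, NNReal.coe_mul,
    Real.coe_toNNReal _ (Real.exp_pos _).le] at h1
  rw [← ENNReal.coe_rpow_of_nonneg _ (by positivity), ENNReal.ofReal, ← ENNReal.coe_mul,
    ENNReal.coe_le_coe, ← NNReal.coe_le_coe, NNReal.coe_mul,
    Real.coe_toNNReal _ (Real.exp_pos _).le, NNReal.coe_rpow] at h
  rw [ENNReal.ofReal, ENNReal.coe_le_coe, ← NNReal.coe_le_coe,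
    Real.coe_toNNReal _ (Real.exp_pos _).le]
  rcases (NNReal.coe_nonneg a).eq_or_lt with h0 | h0
  · rw [← h0]; exact (Real.exp_pos _).le
  have h0' : (0 : ℝ) < a' := by
    refine (NNReal.coe_nonneg a').lt_of_ne' fun h2 => ?_
    rw [h2, Real.zero_rpow (by positivity), mul_zero] at h
    linarith
  have hlog := Real.log_le_log h0 h
  have hlog' := Real.log_le_log (by positivity) h1
  rw [Real.log_mul (Real.exp_ne_zero _) (by positivity), Real.log_exp, Real.log_rpow h0',
    inv_div] at hlog
  rw [Real.log_mul (Real.exp_ne_zero _) h0'.ne', Real.log_exp] at hlog'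
  rw [← Real.log_le_iff_le_exp h0]
  have h2 : (1 + l) * Real.log a ≤ c + l * Real.log a' := by
    have := mul_le_mul_of_nonneg_left hlog hl1.le
    refine this.trans_eq ?_
    field_simp
  nlinarith [mul_le_mul_of_nonneg_left hlog' hl.le]

variable {X : Type u} {Nbr : X → X → Prop} {ι : Type w} [Fintype ι] {E : ι → PrivacyParam}

theorem Analyst.view_le_of_isCDP {Y : ℕ → Type v} [∀ n, MeasurableSpace (Y n)]
    (A : Analyst Nbr E Y) (hNbr : ∀ x x', Nbr x x' → Nbr x' x) {m s : ι → ℝ}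
    (hE : ∀ (i : ι) (Z : Type v) [MeasurableSpace Z] (M : Mechanism X Z),
      (E i).Admits Nbr M → IsCDP Nbr M (m i) (s i))
    (b : Bool) {S : Set (History Y (Fintype.card ι))} (hS : MeasurableSet S)
    {l : ℝ} (hl : 0 < l) (t : ℝ) :
    A.view b S ≤ ENNReal.ofReal (Real.exp t) * A.view (!b) S +
      ENNReal.ofReal (Real.exp (l * (∑ i, m i) + l ^ 2 * (∑ i, s i ^ 2) / 2 - l * t)) := by
  have hprob : IsProbabilityMeasure (A.view b) := A.isProbabilityMeasure_historyLaw b _ le_rfl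
  refine le_exp_mul_add_of_le_rpow hl (measure_ne_top _ _) ?_
  refine (A.view_le_rpow b
    (fun i => ENNReal.ofReal (Real.exp ((l * m i + l ^ 2 * s i ^ 2 / 2) / (1 + l))))
    (q := (1 + l) / l) (by positivity) (fun n hn h f hf => ?_) hS).trans_eq ?_
  · rw [inv_div]
    exact ConcentratedLoss.lintegral_le_rpow
      (hE _ _ _ (A.admits ⟨n, hn⟩ h) _ _ (A.data_nbr hNbr b ⟨n, hn⟩ h)) hl hf
  · rw [← ENNReal.ofReal_prod_of_nonneg fun _ _ => (Real.exp_pos _).le, ← Real.exp_sum,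
      ← Finset.sum_div, Finset.sum_add_distrib, ← Finset.mul_sum, ← Finset.sum_div,
      ← Finset.mul_sum]

/-- Adaptive composition for a family whose parameters all imply concentrated privacy. -/
theorem setwiseDP_of_isCDP (hNbr : ∀ x x', Nbr x x' → Nbr x' x) {m s : ι → ℝ}
    (hE : ∀ (i : ι) (Z : Type v) [MeasurableSpace Z] (M : Mechanism X Z),
      (E i).Admits Nbr M → IsCDP Nbr M (m i) (s i)) {δ : ℝ} (hδ : 0 < δ) :
    SetwiseDP.{u, v, w} Nbr E
      ((∑ i, m i) + Real.sqrt (2 * (∑ i, s i ^ 2) * Real.log (1 / δ))) δ := by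
  intro Y _ A b S hS
  have hprob : ∀ b, IsProbabilityMeasure (A.view b) := fun b =>
    A.isProbabilityMeasure_historyLaw b _ le_rfl
  rcases le_or_gt 1 δ with h1 | h1
  · exact prob_le_one.trans ((ENNReal.one_le_ofReal.2 h1).trans le_add_self)
  set T := ∑ i, s i ^ 2
  set L := Real.log (1 / δ)
  have hT : 0 ≤ T := Finset.sum_nonneg fun i _ => sq_nonneg _
  have hL : 0 < L := Real.log_pos (one_lt_one_div hδ h1)
  -- The optimal `l` is `r / T`, which breaks down when `T = 0`; hence `T` is enlarged by `η`, which
  -- then tends to `0`.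
  have key : ∀ η : ℝ, 0 < η → A.view b S ≤
      ENNReal.ofReal (Real.exp ((∑ i, m i) + Real.sqrt (2 * (T + η) * L))) * A.view (!b) S +
        ENNReal.ofReal δ := by
    intro η hη
    have hTη : 0 < T + η := by linarith
    set r := Real.sqrt (2 * (T + η) * L)
    have hr : r ^ 2 = 2 * (T + η) * L := Real.sq_sqrt (by positivity)
    have hr0 : 0 < r := Real.sqrt_pos.2 (by positivity)
    refine (A.view_le_of_isCDP hNbr hE b hS (l := r / (T + η)) (by positivity)
      ((∑ i, m i) + r)).trans ?_
    gcongr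
    rw [← Real.le_log_iff_exp_le hδ, show Real.log δ = -L by simp [L]]
    -- With `l = r / (T + η)` the exponent is `l² T / 2 - l r ≤ L - 2 L = -L = log δ`.
    have h2 : (r / (T + η)) ^ 2 * T / 2 ≤ (r / (T + η)) ^ 2 * (T + η) / 2 := by
      gcongr; linarith
    have h3 : (r / (T + η)) ^ 2 * (T + η) = 2 * L := by
      rw [div_pow, hr]; field_simp
    have h4 : r / (T + η) * r = 2 * L := by
      rw [div_mul_eq_mul_div, ← sq, hr]; field_simp
    linarith
  have hlim : Filter.Tendsto (fun η : ℝ =>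
      ENNReal.ofReal (Real.exp ((∑ i, m i) + Real.sqrt (2 * (T + η) * L))) * A.view (!b) S +
        ENNReal.ofReal δ) (nhdsWithin 0 (Set.Ioi 0))
      (nhds (ENNReal.ofReal (Real.exp ((∑ i, m i) + Real.sqrt (2 * (T + 0) * L))) *
        A.view (!b) S + ENNReal.ofReal δ)) := by
    refine Filter.Tendsto.mono_left ?_ nhdsWithin_le_nhds
    refine Filter.Tendsto.add_const _ (ENNReal.Tendsto.mul_const ?_ (.inr (measure_ne_top _ _)))
    exact ENNReal.tendsto_ofReal ((by fun_prop : Continuous fun η : ℝ =>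
      Real.exp ((∑ i, m i) + Real.sqrt (2 * (T + η) * L))).tendsto 0)
  rw [add_zero] at hlim
  exact ge_of_tendsto hlim (eventually_nhdsWithin_of_forall fun η hη => key η hη)

end PrivacyComposition

theorem mainTheorem2 {X : Type u} (Nbr : X → X → Prop) (hNbr : ∀ x x', Nbr x x' → Nbr x' x) :
    (∀ (k : ℕ) (μ τ : Fin k → ℝ) (δ : ℝ), 0 < δ →
      PrivacyComposition.SetwiseDP.{u, v, 0} Nbr
        (fun i : Fin k => PrivacyComposition.PrivacyParam.cdp (μ i) (τ i))
        ((∑ i, μ i) + Real.sqrt (2 * (∑ i, τ i ^ 2) * Real.log (1 / δ))) δ) ∧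
    (∀ (mDP mBR mCDP : ℕ) (ε α μ τ δ : ℝ), 0 < ε → 0 < α → 0 < δ →
      PrivacyComposition.SetwiseDP.{u, v, 0} Nbr
        (Sum.elim (fun _ : Fin mDP => PrivacyComposition.PrivacyParam.pureDP ε)
          (Sum.elim (fun _ : Fin mBR => PrivacyComposition.PrivacyParam.boundedRange α)
            (fun _ : Fin mCDP => PrivacyComposition.PrivacyParam.cdp μ τ)))
        (mDP * (ε * ((Real.exp ε - 1) / (Real.exp ε + 1)))
          + mBR * (α / (Real.exp α - 1) - 1 - Real.log (α / (Real.exp α - 1)))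
          + mCDP * μ
          + Real.sqrt (2 * (mDP * ε ^ 2 + mBR / 4 * α ^ 2 + mCDP * τ ^ 2) * Real.log (1 / δ)))
        δ) := by
  refine ⟨fun k μ τ δ hδ => ?_, fun mDP mBR mCDP ε α μ τ δ hε hα hδ => ?_⟩
  · exact PrivacyComposition.setwiseDP_of_isCDP.{u, v, 0} hNbr
      (E := fun i : Fin k => PrivacyComposition.PrivacyParam.cdp (μ i) (τ i))
      (fun _ _ _ _ h => h) hδ
  · have h := PrivacyComposition.setwiseDP_of_isCDP.{u, v, 0} hNbr
      (E := Sum.elim (fun _ : Fin mDP => PrivacyComposition.PrivacyParam.pureDP ε)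
        (Sum.elim (fun _ : Fin mBR => PrivacyComposition.PrivacyParam.boundedRange α)
          (fun _ : Fin mCDP => PrivacyComposition.PrivacyParam.cdp μ τ)))
      (m := Sum.elim (fun _ => ε * ((Real.exp ε - 1) / (Real.exp ε + 1)))
        (Sum.elim (fun _ => α / (Real.exp α - 1) - 1 - Real.log (α / (Real.exp α - 1)))
          (fun _ => μ)))
      -- Hoeffding's `α / 2` for bounded range produces, squared, the coefficient `mBR / 4` under
      -- the root.
      (s := Sum.elim (fun _ => ε) (Sum.elim (fun _ => α / 2) (fun _ => τ)))
      (by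
        rintro (i | i | i) Z _ M hM
        · exact PrivacyComposition.IsDP.isCDP hNbr hε hM
        · exact PrivacyComposition.IsBR.isCDP hα hM
        · exact hM) hδ
    simp only [Fintype.sum_sum_type, Sum.elim_inl, Sum.elim_inr, Finset.sum_const,
      Finset.card_univ, Fintype.card_fin, nsmul_eq_mul] at h
    convert h using 1
    ring_nf
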